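/- Let $Q_1,Q_2,Q_3\in\mathbb R[u,v,w]$ be quadratic forms (homogeneous polynomials of degree $2$) such that the plane quartic curve $\Delta=(Q_1Q_3-Q_2^2=0)\subset\mathbb P^2$ is smooth, i.e. there is no point of $\mathbb P^2(\mathbb C)$ at which $Q_1Q_3-Q_2^2$ and all its first partial derivatives vanish. Let $Y\to\mathbb P^1_{[t_0:t_1]}\times\mathbb P^2_{[u:v:w]}$ be the double cover defined by $$z^2=t_0^2\,Q_1(u,v,w)+2t_0t_1\,Q_2(u,v,w)+t_1^2\,Q_3(u,v,w),$$ where $z$ has bidegree $(1,1)$. Thus $Y(\mathbb R)$ is the set of real solutions $(t_0,t_1;u,v,w;z)$ of this equation with $(t_0,t_1)\ne(0,0)$ and $(u,v,w)\neq(0,0,0)$, modulo the scalings $(t_0,t_1;u,v,w;z)\sim(at_0,at_1;bu,bv,bw;abz)$ for $a,b\in\mathbb R^\times$, with its Euclidean topology (the quotient topology). Then $Y(\mathbb R)$ has at most three connected components. -/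

import Mathlib

namespace DoubleCover

/-- The homogeneous polynomial `f` in three variables over `ℝ` defines a smooth plane curve: at no
point of `ℙ²(ℂ)` do `f` and all its first partial derivatives vanish. -/
def IsSmoothPlaneCurve (f : MvPolynomial (Fin 3) ℝ) : Prop :=
  ∀ p : Fin 3 → ℂ, p ≠ 0 → MvPolynomial.aeval p f = 0 →
    ∃ i : Fin 3, MvPolynomial.aeval p (MvPolynomial.pderiv i f) ≠ 0

/-- The homogeneous coordinates `(t, x, z)`, `t = (t₀, t₁) ≠ 0`, `x = (u, v, w) ≠ 0`, of the real
points of the double cover `z² = t₀² Q₁(x) + 2 t₀ t₁ Q₂(x) + t₁² Q₃(x)` of `ℙ¹ × ℙ²`. -/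
def coordinates (Q₁ Q₂ Q₃ : MvPolynomial (Fin 3) ℝ) :
    Set ((Fin 2 → ℝ) × (Fin 3 → ℝ) × ℝ) :=
  {p | p.1 ≠ 0 ∧ p.2.1 ≠ 0 ∧
    p.2.2 ^ 2 = p.1 0 ^ 2 * MvPolynomial.eval p.2.1 Q₁
      + 2 * p.1 0 * p.1 1 * MvPolynomial.eval p.2.1 Q₂
      + p.1 1 ^ 2 * MvPolynomial.eval p.2.1 Q₃}

/-- Two coordinate vectors give the same point when they differ by the scaling
`(t, x, z) ↦ (a t, b x, a b z)` with `a, b ∈ ℝˣ`. The coordinate `z` has bidegree `(1, 1)`: it is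
the fibre coordinate of the line bundle `𝒪(1, 1)`, in which the double cover lives. -/
def scaling (Q₁ Q₂ Q₃ : MvPolynomial (Fin 3) ℝ) : Setoid (coordinates Q₁ Q₂ Q₃) where
  r p q := ∃ a b : ℝˣ, q.1 =
    ((a : ℝ) • p.1.1, (b : ℝ) • p.1.2.1, (a : ℝ) * (b : ℝ) * p.1.2.2)
  iseqv :=
    { refl := fun p => ⟨1, 1, by simp⟩
      symm := by
        rintro p q ⟨a, b, h⟩
        refine ⟨a⁻¹, b⁻¹, ?_⟩
        rw [h]
        refine Prod.ext ?_ (Prod.ext ?_ ?_)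
        · simp [smul_smul]
        · simp [smul_smul]
        · have ha := a.ne_zero
          have hb := b.ne_zero
          simp only [Units.val_inv_eq_inv_val]
          field_simp
      trans := by
        rintro p q r ⟨a, b, h⟩ ⟨c, d, k⟩
        refine ⟨c * a, d * b, ?_⟩
        rw [k, h]
        refine Prod.ext ?_ (Prod.ext ?_ ?_)
        · simp [smul_smul]
        · simp [smul_smul]
        · simp only [Units.val_mul]
          ring }

/-- The real locus `Y(ℝ)` of the double cover `Y → ℙ¹ × ℙ²` with equation
`z² = t₀² Q₁ + 2 t₀ t₁ Q₂ + t₁² Q₃`. -/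
def RealLocus (Q₁ Q₂ Q₃ : MvPolynomial (Fin 3) ℝ) : Type :=
  Quotient (scaling Q₁ Q₂ Q₃)

/-- The Euclidean topology on `Y(ℝ)`: the quotient of the subspace topology from
`ℝ² × ℝ³ × ℝ`. -/
instance (Q₁ Q₂ Q₃ : MvPolynomial (Fin 3) ℝ) : TopologicalSpace (RealLocus Q₁ Q₂ Q₃) :=
  inferInstanceAs (TopologicalSpace (Quotient (scaling Q₁ Q₂ Q₃)))

end DoubleCover

/-! Project Y(ℝ) to ℙ¹(ℝ). With M(t) the symmetric matrix `pencil A₁ A₂ A₃ t`, the fibre over t is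
the quadric z² = xᵀM(t)x in ℙ³(ℝ): empty exactly when M(t) is negative definite, connected otherwise
(`joinedIn_isotropicCone`). Hence Y(ℝ) has at most one component over each arc of ℙ¹(ℝ) free of
negative definite points (`component_eq_of_path`).

If some M(t) is negative definite, put that t at infinity. Four components would give four
parameters on the line, interlaced with five negative definite ones. Each passage into or out of the
negative definite matrices crosses det = 0 (`exists_det_eq_zero`), so a nonzero polynomial of degree
at most six would have eight roots (`not_negDef_interlacing`). -/

namespace DoubleCover

open Matrix Topology Set

/-! ### Connectedness of real projective quadrics -/

section Quadric

variable {V : Type*} [AddCommGroup V] [Module ℝ V] [TopologicalSpace V] [ContinuousAdd V]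
  [ContinuousSMul ℝ V]

/-- The nonzero isotropic vectors of a bilinear form. -/
def isotropicCone (B : LinearMap.BilinForm ℝ V) : Set V := {v | v ≠ 0 ∧ B v v = 0}

theorem joinedIn_isotropicCone_of_orthogonal {B : LinearMap.BilinForm ℝ V} (hB : B.IsSymm)
    {v w : V} (hv : v ∈ isotropicCone B) (hw : w ∈ isotropicCone B) (hvw : B v w = 0) :
    ∃ c : ℝ, c ≠ 0 ∧ JoinedIn (isotropicCone B) v (c • w) := by
  by_cases hli : LinearIndependent ℝ ![v, w]
  · refine ⟨1, one_ne_zero, ?_⟩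
    refine JoinedIn.ofLine (f := fun s : ℝ => (1 - s) • v + s • w) (by fun_prop) (by simp)
      (by simp) ?_
    rintro _ ⟨s, -, rfl⟩
    have hwv : B w v = 0 := by rw [hB.eq, hvw]
    refine ⟨fun h => ?_, by simp [hv.2, hw.2, hvw, hwv]⟩
    obtain ⟨h1, h2⟩ := LinearIndependent.pair_iff.1 hli _ _ h
    linarith
  · obtain ⟨a, ha⟩ : ∃ a : ℝ, a • w = v := by
      by_contra! h
      exact hli (LinearIndependent.pair_symm_iff.1
        ((LinearIndependent.pair_iff' hw.1).2 h))
    refine ⟨a, ?_, ?_⟩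
    · rintro rfl
      exact hv.1 (by simpa using ha.symm)
    · rw [ha]
      exact JoinedIn.refl hv

/-- A real projective quadric of positive dimension is path connected. -/
theorem joinedIn_isotropicCone {B : LinearMap.BilinForm ℝ V} (hB : B.IsSymm)
    [FiniteDimensional ℝ V] (hV : 2 < Module.finrank ℝ V)
    {v w : V} (hv : v ∈ isotropicCone B) (hw : w ∈ isotropicCone B) :
    ∃ c : ℝ, c ≠ 0 ∧ JoinedIn (isotropicCone B) v (c • w) := by
  by_cases hvw : B v w = 0
  · exact joinedIn_isotropicCone_of_orthogonal hB hv hw hvw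
  have hwv : B w v = B v w := hB.eq _ _
  -- Two linear conditions on a space of dimension at least three leave a nonzero u orthogonal to
  -- both v and w.
  obtain ⟨u, hu, hu0⟩ : ∃ u ∈ LinearMap.ker ((B v).prod (B w)), u ≠ 0 :=
    (Submodule.ne_bot_iff _).1 (LinearMap.ker_ne_bot_of_finrank_lt (by simpa using hV))
  obtain ⟨hvu, hwu⟩ : B v u = 0 ∧ B w u = 0 := by simpa using hu
  have huv : B u v = 0 := by rw [hB.eq, hvu]
  have huw : B u w = 0 := by rw [hB.eq, hwu]
  by_cases huu : B u u = 0
  · obtain ⟨c, hc, h⟩ := joinedIn_isotropicCone_of_orthogonal hB hv ⟨hu0, huu⟩ hvu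
    obtain ⟨d, hd, h'⟩ := joinedIn_isotropicCone_of_orthogonal hB (v := c • u)
      ⟨smul_ne_zero hc hu0, by simp [huu]⟩ hw (by simp [huw])
    exact ⟨d, hd, h.trans h'⟩
  -- Join v to w along a conic in the span of v, w, u; this c cancels the only surviving terms, both
  -- multiples of s²(1 - s)². Pairing with v and w shows that the conic avoids 0.
  · refine ⟨-B u u / (2 * B v w), by simp [huu, hvw], ?_⟩
    set c := -B u u / (2 * B v w) with hc
    have hcB : 2 * (c * B v w) = -B u u := by rw [hc]; field_simp
    refine JoinedIn.ofLine (f := fun s : ℝ => (1 - s) ^ 2 • v + s ^ 2 • (c • w)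
      + (s * (1 - s)) • u) (by fun_prop) (by simp) (by simp) ?_
    rintro _ ⟨s, -, rfl⟩
    refine ⟨fun h => ?_, ?_⟩
    · have h1 := congrArg (B v) h
      have h2 := congrArg (B w) h
      have hc0 : c ≠ 0 := by simp [hc, huu, hvw]
      simp [hv.2, hvu, hvw, hc0] at h1
      simp [hwv, hvw, h1] at h2
    · simp only [map_add, map_smul, LinearMap.add_apply, LinearMap.smul_apply, smul_eq_mul,
        hv.2, hw.2, hvu, hwu, huv, huw, hwv]
      linear_combination (s ^ 2 * (1 - s) ^ 2) * hcB

end Quadric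

/-! ### Negative definite matrices and the zeros of the determinant -/

section NegDef

variable {n : Type*} [Fintype n]

/-- The quadratic form of a real matrix takes negative values at all nonzero vectors. -/
def NegDef (M : Matrix n n ℝ) : Prop := ∀ x : n → ℝ, x ≠ 0 → x ⬝ᵥ M *ᵥ x < 0

theorem smul_dotProduct_mulVec_smul (M : Matrix n n ℝ) (a : ℝ) (x : n → ℝ) :
    (a • x) ⬝ᵥ M *ᵥ (a • x) = a ^ 2 * (x ⬝ᵥ M *ᵥ x) := by
  simp [mulVec_smul]
  ring

theorem exists_norm_eq_one_smul {x : n → ℝ} (hx : x ≠ 0) :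
    ∃ a : ℝ, a ≠ 0 ∧ ‖a • x‖ = 1 := by
  refine ⟨‖x‖⁻¹, by simpa using hx, ?_⟩
  rw [norm_smul, norm_inv, norm_norm, inv_mul_cancel₀ (by simpa using hx)]

/-- Normalizing to the compact unit sphere turns failure of negative definiteness into a closed
condition with compact fibres. -/
theorem not_negDef_iff {M : Matrix n n ℝ} :
    ¬ NegDef M ↔ ∃ x : n → ℝ, ‖x‖ = 1 ∧ 0 ≤ x ⬝ᵥ M *ᵥ x := by
  constructor
  · intro h
    simp only [NegDef, not_forall, not_lt] at h
    obtain ⟨x, hx, h⟩ := h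
    obtain ⟨a, -, hax⟩ := exists_norm_eq_one_smul hx
    exact ⟨a • x, hax, by rw [smul_dotProduct_mulVec_smul]; positivity⟩
  · rintro ⟨x, hx, h⟩ hM
    exact (hM x (by rintro rfl; simp at hx)).not_ge h

theorem NegDef.smul {M : Matrix n n ℝ} (hM : NegDef M) {a : ℝ} (ha : 0 < a) :
    NegDef (a • M) := by
  intro x hx
  simpa [smul_mulVec] using mul_neg_of_pos_of_neg ha (hM x hx)

theorem eventually_negDef {X : Type*} [TopologicalSpace X] {M : X → Matrix n n ℝ}
    (hM : Continuous M) {a : X} (ha : NegDef (M a)) : ∀ᶠ s in 𝓝 a, NegDef (M s) := by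
  have h : ∀ᶠ s in 𝓝 a, ∀ x ∈ Metric.sphere (0 : n → ℝ) 1, x ⬝ᵥ M s *ᵥ x < 0 := by
    refine (isCompact_sphere _ _).eventually_forall_of_forall_eventually fun x hx => ?_
    refine ContinuousAt.eventually_lt
      (f := fun z : X × (n → ℝ) => z.2 ⬝ᵥ M z.1 *ᵥ z.2) (g := fun _ => 0) ?_ ?_ ?_
    · exact Continuous.continuousAt (by fun_prop)
    · exact continuousAt_const
    · exact ha x (by rintro rfl; simp at hx)
  filter_upwards [h] with s hs
  by_contra hc
  obtain ⟨x, hx, hx'⟩ := not_negDef_iff.1 hc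
  exact (hs x (by simpa using hx)).not_ge hx'

theorem NegDef.det_ne_zero [DecidableEq n] {M : Matrix n n ℝ} (hM : NegDef M) : M.det ≠ 0 := by
  intro h
  obtain ⟨x, hx, hx'⟩ := exists_mulVec_eq_zero_iff.2 h
  simpa [hx'] using hM x hx

/-- A path of symmetric matrices that leaves the negative definite ones crosses the
determinantal hypersurface. -/
theorem exists_det_eq_zero [DecidableEq n] {M : ℝ → Matrix n n ℝ} (hM : Continuous M)
    (hs : ∀ s, (M s).IsSymm) {a b : ℝ} (hab : a < b) (ha : NegDef (M a)) {y : n → ℝ}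
    (hb : 0 < y ⬝ᵥ M b *ᵥ y) : ∃ c ∈ Ioo a b, (M c).det = 0 := by
  have hbn : ¬ NegDef (M b) := fun h => (h y (by rintro rfl; simp at hb)).not_gt hb
  have hK : IsCompact ((Icc a b ×ˢ Metric.sphere (0 : n → ℝ) 1) ∩
      {z : ℝ × (n → ℝ) | 0 ≤ z.2 ⬝ᵥ M z.1 *ᵥ z.2}) :=
    (isCompact_Icc.prod (isCompact_sphere _ _)).inter_right
      (isClosed_le continuous_const (by fun_prop))
  have hmem : ∀ s ∈ Icc a b, ¬ NegDef (M s) → s ∈ Prod.fst ''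
      ((Icc a b ×ˢ Metric.sphere (0 : n → ℝ) 1) ∩
      {z : ℝ × (n → ℝ) | 0 ≤ z.2 ⬝ᵥ M z.1 *ᵥ z.2}) := by
    intro s hs h
    obtain ⟨x, hx, hx'⟩ := not_negDef_iff.1 h
    exact ⟨(s, x), ⟨⟨hs, by simpa using hx⟩, hx'⟩, rfl⟩
  -- c is the first parameter where negative definiteness fails. There the form is still ≤ 0 but
  -- vanishes at x ≠ 0, so x lies in the kernel.
  obtain ⟨c, ⟨⟨_, x⟩, ⟨⟨hcI, hx⟩, hcx⟩, rfl⟩, hmin⟩ :=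
    (hK.image continuous_fst).exists_isLeast ⟨b, hmem b ⟨hab.le, le_rfl⟩ hbn⟩
  rename_i c
  simp only [mem_ofPred_eq] at hcI hcx hmin
  have hx0 : x ≠ 0 := by rintro rfl; simp at hx
  have hac : a < c := by
    refine lt_of_le_of_ne hcI.1 ?_
    rintro rfl
    exact (ha x hx0).not_ge hcx
  have hle : ∀ z : n → ℝ, z ⬝ᵥ M c *ᵥ z ≤ 0 := by
    intro z
    by_contra! hz
    have hev : ∀ᶠ s in 𝓝[<] c, 0 < z ⬝ᵥ M s *ᵥ z :=
      (continuousAt_const.eventually_lt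
        (Continuous.continuousAt (f := fun s => z ⬝ᵥ M s *ᵥ z) (by fun_prop)) hz).filter_mono
        nhdsWithin_le_nhds
    obtain ⟨s, hs, hsI⟩ := (hev.and (Ioo_mem_nhdsLT hac)).exists
    have := hmin (hmem s ⟨hsI.1.le, hsI.2.le.trans hcI.2⟩ fun h =>
      (h z (by rintro rfl; simp at hs)).not_gt hs)
    exact this.not_gt hsI.2
  refine ⟨c, ⟨hac, lt_of_le_of_ne hcI.2 ?_⟩, ?_⟩
  · rintro rfl
    exact (hle y).not_gt hb
  · have hpsd : (-M c).PosSemidef := by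
      refine PosSemidef.of_dotProduct_mulVec_nonneg ?_ fun z => ?_
      · exact IsHermitian.neg (by rw [IsHermitian, conjTranspose_eq_transpose_of_trivial]; exact hs c)
      · simpa [neg_mulVec] using hle z
    have h0 := (hpsd.dotProduct_mulVec_zero_iff x).1
      (by simpa [neg_mulVec] using le_antisymm (hle x) hcx)
    exact exists_mulVec_eq_zero_iff.1 ⟨x, hx0, by simpa [neg_mulVec] using h0⟩

theorem exists_det_eq_zero' [DecidableEq n] {M : ℝ → Matrix n n ℝ} (hM : Continuous M)
    (hs : ∀ s, (M s).IsSymm) {a b : ℝ} (hab : a < b) (hb : NegDef (M b)) {y : n → ℝ}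
    (ha : 0 < y ⬝ᵥ M a *ᵥ y) : ∃ c ∈ Ioo a b, (M c).det = 0 := by
  obtain ⟨c, hc, h⟩ := exists_det_eq_zero (M := fun s => M (-s)) (by fun_prop) (fun s => hs _)
    (neg_lt_neg hab) (by simpa using hb) (y := y) (by simpa using ha)
  exact ⟨-c, ⟨by linarith [hc.2], by linarith [hc.1]⟩, h⟩

end NegDef

/-- The determinant of a quadratic family of `3 × 3` matrices has at most six zeros. -/
theorem det_quadratic_family_zeros (B₀ B₁ B₂ : Matrix (Fin 3) (Fin 3) ℝ) {a : ℝ}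
    (ha : (a ^ 2 • B₂ + a • B₁ + B₀).det ≠ 0) {k : ℕ} {c : Fin k → ℝ} (hc : StrictMono c)
    (h : ∀ i, (c i ^ 2 • B₂ + c i • B₁ + B₀).det = 0) : k ≤ 6 := by
  let P : Matrix (Fin 3) (Fin 3) (Polynomial ℝ) := Matrix.of fun i j =>
    .C (B₂ i j) * .X ^ 2 + .C (B₁ i j) * .X + .C (B₀ i j)
  have hP : ∀ s, P.det.eval s = (s ^ 2 • B₂ + s • B₁ + B₀).det := by
    intro s
    rw [← Polynomial.coe_evalRingHom, RingHom.map_det]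
    congr 1
    ext i j
    simp [P]
    ring
  have hdeg : P.det.natDegree ≤ 6 := by
    have hij : ∀ i j, (P i j).natDegree ≤ 2 := by
      intro i j
      simp only [P, Matrix.of_apply]
      compute_degree
    rw [Matrix.det_apply]
    refine Polynomial.natDegree_sum_le_of_forall_le _ _ fun σ _ => ?_
    refine (Polynomial.natDegree_smul_le _ _).trans ?_
    refine (Polynomial.natDegree_prod_le _ _).trans ?_
    exact (Finset.sum_le_sum fun i _ => hij _ _).trans (by simp)
  have hP0 : P.det ≠ 0 := fun h0 => ha (by rw [← hP, h0, Polynomial.eval_zero])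
  have := Polynomial.card_le_degree_of_subset_roots (p := P.det)
    (Z := Finset.univ.map ⟨c, hc.injective⟩) (by
      intro r hr
      rw [Finset.mem_val] at hr
      obtain ⟨i, -, rfl⟩ := Finset.mem_map.1 hr
      simpa [hP0, hP] using h i)
  simp at this
  omega

/-- In a quadratic family of symmetric `3 × 3` matrices the negative definite ones do not
separate four others. -/
theorem not_negDef_interlacing {B₀ B₁ B₂ : Matrix (Fin 3) (Fin 3) ℝ} (h₀ : B₀.IsSymm)
    (h₁ : B₁.IsSymm) (h₂ : B₂.IsSymm) {ν : Fin 5 → ℝ} {s : Fin 4 → ℝ}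
    (hν : ∀ i, NegDef (ν i ^ 2 • B₂ + ν i • B₁ + B₀))
    (hs : ∀ i, ¬ NegDef (s i ^ 2 • B₂ + s i • B₁ + B₀))
    (hνs : ∀ i : Fin 4, ν i.castSucc < s i) (hsν : ∀ i : Fin 4, s i < ν i.succ) : False := by
  -- Two of the crossings could coincide where the family only touches the boundary. Adding a small
  -- ε • 1 keeps the five matrices negative definite and makes the form strictly positive somewhere
  -- at each `s i`, so roots on either side of `s i` are distinct.
  have hev : ∀ i, ∀ᶠ ε : ℝ in 𝓝 0,
      NegDef (ν i ^ 2 • B₂ + ν i • B₁ + (B₀ + ε • (1 : Matrix (Fin 3) (Fin 3) ℝ))) := fun i =>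
    eventually_negDef (by fun_prop) (by simpa using hν i)
  obtain ⟨ε, hε, hε0⟩ := (((Filter.eventually_all.2 hev).filter_mono nhdsWithin_le_nhds).and
    (self_mem_nhdsWithin (s := Ioi (0 : ℝ)))).exists
  set B := B₀ + ε • (1 : Matrix (Fin 3) (Fin 3) ℝ) with hB
  have hBs : B.IsSymm := h₀.add (isSymm_one.smul ε)
  have hsymm : ∀ r : ℝ, (r ^ 2 • B₂ + r • B₁ + B).IsSymm := fun r =>
    ((h₂.smul _).add (h₁.smul _)).add hBs
  have hpos : ∀ i, ∃ y : Fin 3 → ℝ, 0 < y ⬝ᵥ (s i ^ 2 • B₂ + s i • B₁ + B) *ᵥ y := by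
    intro i
    obtain ⟨y, hy, hy'⟩ := not_negDef_iff.1 (hs i)
    have hy0 : y ≠ 0 := by rintro rfl; simp at hy
    refine ⟨y, ?_⟩
    rw [hB, ← add_assoc, add_mulVec, dotProduct_add, smul_mulVec, one_mulVec, dotProduct_smul,
      smul_eq_mul]
    have : 0 < y ⬝ᵥ y := by simpa using dotProduct_star_self_pos_iff.2 hy0
    have := mul_pos hε0 this
    linarith
  choose y hy using hpos
  choose c hc hc' using fun i : Fin 4 => exists_det_eq_zero
    (M := fun r : ℝ => r ^ 2 • B₂ + r • B₁ + B) (by fun_prop) hsymm (hνs i) (hε _) (hy i)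
  choose d hd hd' using fun i : Fin 4 => exists_det_eq_zero'
    (M := fun r : ℝ => r ^ 2 • B₂ + r • B₁ + B) (by fun_prop) hsymm (hsν i) (hε _) (hy i)
  have hcd : ∀ i, c i < d i := fun i => (hc i).2.trans (hd i).1
  have hdc : ∀ i j : Fin 4, i.succ = j.castSucc → d i < c j := fun i j hij =>
    ((hd i).2.trans_eq (by rw [hij])).trans (hc j).1
  have := det_quadratic_family_zeros B B₁ B₂ (hε 0).det_ne_zero (k := 8)
    (c := ![c 0, d 0, c 1, d 1, c 2, d 2, c 3, d 3])
    (Fin.strictMono_iff_lt_succ.2 (by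
      intro i
      fin_cases i
      exacts [hcd 0, hdc 0 1 rfl, hcd 1, hdc 1 2 rfl, hcd 2, hdc 2 3 rfl, hcd 3]))
    (by
      intro i
      fin_cases i
      exacts [hc' 0, hd' 0, hc' 1, hd' 1, hc' 2, hd' 2, hc' 3, hd' 3])
  omega

/-! ### Symmetric matrices of quadratic forms and their pencil -/

/-- A quadratic form is given by a symmetric matrix. -/
theorem exists_isSymm_matrix_eval {n : Type*} [Fintype n] {Q : MvPolynomial n ℝ}
    (hQ : Q.IsHomogeneous 2) :
    ∃ A : Matrix n n ℝ, A.IsSymm ∧ ∀ x, MvPolynomial.eval x Q = x ⬝ᵥ A *ᵥ x := by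
  have hconst : ∀ i j, ∃ c : ℝ, MvPolynomial.pderiv j (MvPolynomial.pderiv i Q) = MvPolynomial.C c := fun i j =>
    ⟨_, MvPolynomial.totalDegree_eq_zero_iff_eq_C.1
      ((MvPolynomial.totalDegree_zero_iff_isHomogeneous _).2 (hQ.pderiv (i := i)).pderiv)⟩
  choose c hc using hconst
  let A : Matrix n n ℝ := Matrix.of c
  have hA : ∀ x, MvPolynomial.eval x Q = (1 / 2 : ℝ) * (x ⬝ᵥ A *ᵥ x) := by
    intro x
    have h1 := congrArg (MvPolynomial.eval x) hQ.sum_X_mul_pderiv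
    have h2 : ∀ i, MvPolynomial.eval x (MvPolynomial.pderiv i Q) = (A *ᵥ x) i := by
      intro i
      have := congrArg (MvPolynomial.eval x) (hQ.pderiv (i := i)).sum_X_mul_pderiv
      simp [hc] at this
      simp [A, mulVec, dotProduct, ← this, mul_comm]
    simp [h2] at h1
    simp only [dotProduct]
    linarith
  -- Euler's identity used twice gives the factor 1/2; symmetrizing the matrix of second derivatives
  -- gives the other.
  refine ⟨(1 / 4 : ℝ) • (A + Aᵀ), (isSymm_add_transpose_self A).smul _, fun x => ?_⟩
  have hT : x ⬝ᵥ Aᵀ *ᵥ x = x ⬝ᵥ A *ᵥ x := by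
    rw [mulVec_transpose, dotProduct_comm, dotProduct_mulVec]
  rw [hA, smul_mulVec, dotProduct_smul, add_mulVec, dotProduct_add, hT, smul_eq_mul]
  ring

/-- The matrix of the quadratic form `t₀² A₁ + 2 t₀ t₁ A₂ + t₁² A₃`. -/
def pencil {n : Type*} (A₁ A₂ A₃ : Matrix n n ℝ) (t : Fin 2 → ℝ) : Matrix n n ℝ :=
  t 0 ^ 2 • A₁ + (2 * t 0 * t 1) • A₂ + t 1 ^ 2 • A₃

section Pencil

variable {n : Type*} {A₁ A₂ A₃ : Matrix n n ℝ}

theorem continuous_pencil : Continuous (pencil A₁ A₂ A₃) := by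
  unfold pencil
  fun_prop

theorem pencil_smul (a : ℝ) (t : Fin 2 → ℝ) :
    pencil A₁ A₂ A₃ (a • t) = a ^ 2 • pencil A₁ A₂ A₃ t := by
  ext i j
  simp [pencil]
  ring

theorem pencil_isSymm (h₁ : A₁.IsSymm) (h₂ : A₂.IsSymm) (h₃ : A₃.IsSymm) (t : Fin 2 → ℝ) :
    (pencil A₁ A₂ A₃ t).IsSymm :=
  ((h₁.smul _).add (h₂.smul _)).add (h₃.smul _)

/-- In the affine chart s ↦ s t + e, with t at infinity, the pencil is a quadratic family in s. -/
theorem pencil_smul_add (t e : Fin 2 → ℝ) (s : ℝ) :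
    pencil A₁ A₂ A₃ (s • t + e) = s ^ 2 • pencil A₁ A₂ A₃ t
      + s • ((2 * t 0 * e 0) • A₁ + (2 * (t 0 * e 1 + t 1 * e 0)) • A₂ + (2 * t 1 * e 1) • A₃)
      + pencil A₁ A₂ A₃ e := by
  ext i j
  simp [pencil]
  ring

theorem NegDef.pencil_smul [Fintype n] {t : Fin 2 → ℝ} (h : NegDef (pencil A₁ A₂ A₃ t)) {a : ℝ}
    (ha : a ≠ 0) : NegDef (pencil A₁ A₂ A₃ (a • t)) := by
  rw [DoubleCover.pencil_smul]
  exact h.smul (by positivity)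

/-- Negative definiteness is an open condition at the point `t` of the projective line. -/
theorem eventually_negDef_pencil [Fintype n] {t : Fin 2 → ℝ} (h : NegDef (pencil A₁ A₂ A₃ t))
    (e : Fin 2 → ℝ) {l : Filter ℝ} (hl : Filter.Tendsto (fun s : ℝ => s⁻¹) l (𝓝 0))
    (hl0 : ∀ᶠ s in l, s ≠ 0) : ∀ᶠ s in l, NegDef (pencil A₁ A₂ A₃ (s • t + e)) := by
  -- s t + e is proportional to t + s⁻¹ e, which tends to t.
  have hev : ∀ᶠ r : ℝ in 𝓝 0, NegDef (pencil A₁ A₂ A₃ (t + r • e)) :=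
    eventually_negDef (M := fun r : ℝ => pencil A₁ A₂ A₃ (t + r • e))
      (continuous_pencil.comp (by fun_prop)) (by simpa using h)
  filter_upwards [hl.eventually hev, hl0] with s hs hs0
  have := hs.pencil_smul hs0
  rwa [smul_add, smul_inv_smul₀ hs0] at this

end Pencil

/-! ### Connected components of Y(ℝ) -/

section Components

variable {Q₁ Q₂ Q₃ : MvPolynomial (Fin 3) ℝ} {A₁ A₂ A₃ : Matrix (Fin 3) (Fin 3) ℝ}

/-- The connected component of the point of `Y(ℝ)` with given homogeneous coordinates. -/
def component (p : coordinates Q₁ Q₂ Q₃) : ConnectedComponents (RealLocus Q₁ Q₂ Q₃) :=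
  ConnectedComponents.mk (Quotient.mk (scaling Q₁ Q₂ Q₃) p : RealLocus Q₁ Q₂ Q₃)

theorem continuous_component : Continuous (component (Q₁ := Q₁) (Q₂ := Q₂) (Q₃ := Q₃)) :=
  ConnectedComponents.continuous_coe.comp continuous_quot_mk

theorem component_surjective :
    Function.Surjective (component (Q₁ := Q₁) (Q₂ := Q₂) (Q₃ := Q₃)) :=
  ConnectedComponents.surjective_coe.comp Quotient.mk_surjective

theorem component_eq_of_scaling {p q : coordinates Q₁ Q₂ Q₃} {a b : ℝ} (ha : a ≠ 0)
    (hb : b ≠ 0) (h : q.1 = (a • p.1.1, b • p.1.2.1, a * b * p.1.2.2)) :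
    component p = component q :=
  congrArg ConnectedComponents.mk (Quotient.sound ⟨Units.mk0 a ha, Units.mk0 b hb, h⟩)

/-- The space of connected components is totally disconnected. -/
theorem eq_of_continuous_component {X : Type*} [TopologicalSpace X] [PreconnectedSpace X]
    {f : X → ConnectedComponents (RealLocus Q₁ Q₂ Q₃)} (hf : Continuous f) (x y : X) :
    f x = f y :=
  (isPreconnected_range hf).subsingleton (mem_range_self x) (mem_range_self y)

theorem mem_coordinates_iff (h₁ : ∀ x, MvPolynomial.eval x Q₁ = x ⬝ᵥ A₁ *ᵥ x)
    (h₂ : ∀ x, MvPolynomial.eval x Q₂ = x ⬝ᵥ A₂ *ᵥ x)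
    (h₃ : ∀ x, MvPolynomial.eval x Q₃ = x ⬝ᵥ A₃ *ᵥ x) {p : (Fin 2 → ℝ) × (Fin 3 → ℝ) × ℝ} :
    p ∈ coordinates Q₁ Q₂ Q₃ ↔ p.1 ≠ 0 ∧ p.2.1 ≠ 0 ∧
      p.2.2 ^ 2 = p.2.1 ⬝ᵥ pencil A₁ A₂ A₃ p.1 *ᵥ p.2.1 := by
  simp [coordinates, pencil, h₁, h₂, h₃, add_mulVec, smul_mulVec]

/-- The form `xᵀ M x - z²`. -/
def coverForm (M : Matrix (Fin 3) (Fin 3) ℝ) : LinearMap.BilinForm ℝ ((Fin 3 → ℝ) × ℝ) :=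
  (Matrix.toBilin' M).comp (LinearMap.fst ℝ _ _) (LinearMap.fst ℝ _ _)
    - (LinearMap.mul ℝ ℝ).compl₁₂ (LinearMap.snd ℝ _ _) (LinearMap.snd ℝ _ _)

theorem coverForm_apply (M : Matrix (Fin 3) (Fin 3) ℝ) (v w : (Fin 3 → ℝ) × ℝ) :
    coverForm M v w = v.1 ⬝ᵥ M *ᵥ w.1 - v.2 * w.2 := by
  simp [coverForm, Matrix.toBilin'_apply']

theorem coverForm_isSymm {M : Matrix (Fin 3) (Fin 3) ℝ} (hM : M.IsSymm) :
    (coverForm M).IsSymm := by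
  refine ⟨fun v w => ?_⟩
  simp only [coverForm_apply]
  rw [dotProduct_mulVec, ← mulVec_transpose, hM.eq, dotProduct_comm, mul_comm]

/-- Since x = 0 forces z = 0, the condition x ≠ 0 removes no point from the quadric in ℙ³. -/
theorem mem_isotropicCone_coverForm {M : Matrix (Fin 3) (Fin 3) ℝ} {v : (Fin 3 → ℝ) × ℝ} :
    v ∈ isotropicCone (coverForm M) ↔ v.1 ≠ 0 ∧ v.2 ^ 2 = v.1 ⬝ᵥ M *ᵥ v.1 := by
  obtain ⟨x, z⟩ := v
  simp only [isotropicCone, mem_ofPred_eq, coverForm_apply, sub_eq_zero, ne_eq, Prod.mk_eq_zero,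
    ← sq]
  refine ⟨fun h => ⟨fun hx => h.1 ⟨hx, ?_⟩, h.2.symm⟩, fun h => ⟨fun h' => h.1 h'.1, h.2.symm⟩⟩
  simpa [hx] using h.2.symm

variable (h₁ : ∀ x, MvPolynomial.eval x Q₁ = x ⬝ᵥ A₁ *ᵥ x)
  (h₂ : ∀ x, MvPolynomial.eval x Q₂ = x ⬝ᵥ A₂ *ᵥ x)
  (h₃ : ∀ x, MvPolynomial.eval x Q₃ = x ⬝ᵥ A₃ *ᵥ x)
  (s₁ : A₁.IsSymm) (s₂ : A₂.IsSymm) (s₃ : A₃.IsSymm)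

include h₁ h₂ h₃

theorem not_negDef_of_mem_coordinates {p : (Fin 2 → ℝ) × (Fin 3 → ℝ) × ℝ}
    (hp : p ∈ coordinates Q₁ Q₂ Q₃) : ¬ NegDef (pencil A₁ A₂ A₃ p.1) := by
  obtain ⟨-, hx, hz⟩ := (mem_coordinates_iff h₁ h₂ h₃).1 hp
  exact fun h => (h _ hx).not_ge (hz ▸ sq_nonneg _)

include s₁ s₂ s₃

/-- The fibres of `Y(ℝ) → ℙ¹(ℝ)` are connected. -/
theorem component_eq_of_fst_eq {p q : coordinates Q₁ Q₂ Q₃} (hpq : p.1.1 = q.1.1) :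
    component p = component q := by
  obtain ⟨⟨t, v⟩, hp⟩ := p
  obtain ⟨⟨t', w⟩, hq⟩ := q
  obtain rfl : t = t' := hpq
  have hp' := (mem_coordinates_iff h₁ h₂ h₃).1 hp
  have hq' := (mem_coordinates_iff h₁ h₂ h₃).1 hq
  -- The quadric lives in a space of dimension 4; the factor c is absorbed by the scaling a = 1, b =
  -- c.
  obtain ⟨c, hc, γ, hγ⟩ := joinedIn_isotropicCone
    (coverForm_isSymm (pencil_isSymm s₁ s₂ s₃ t)) (by simp)
    (mem_isotropicCone_coverForm.2 hp'.2) (mem_isotropicCone_coverForm.2 hq'.2)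
  have hmem : ∀ r, (t, γ r) ∈ coordinates Q₁ Q₂ Q₃ := fun r =>
    (mem_coordinates_iff h₁ h₂ h₃).2 ⟨hp'.1, mem_isotropicCone_coverForm.1 (hγ r)⟩
  have h01 := eq_of_continuous_component
    (f := fun r => component (⟨(t, γ r), hmem r⟩ : coordinates Q₁ Q₂ Q₃))
    (continuous_component.comp (by fun_prop)) 0 1
  simp only [Path.source, Path.target] at h01
  rw [h01]
  exact (component_eq_of_scaling one_ne_zero hc (by simp [Prod.ext_iff])).symm

theorem component_eq_of_fst_eq_smul {p q : coordinates Q₁ Q₂ Q₃} {a : ℝ} (ha : a ≠ 0)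
    (hpq : q.1.1 = a • p.1.1) : component p = component q := by
  have hp := (mem_coordinates_iff h₁ h₂ h₃).1 p.2
  have hmem : (a • p.1.1, p.1.2.1, a * p.1.2.2) ∈ coordinates Q₁ Q₂ Q₃ := by
    refine (mem_coordinates_iff h₁ h₂ h₃).2 ⟨smul_ne_zero ha hp.1, hp.2.1, ?_⟩
    simp only [pencil_smul, smul_mulVec, dotProduct_smul, smul_eq_mul, ← hp.2.2]
    ring
  rw [component_eq_of_scaling (q := ⟨_, hmem⟩) ha one_ne_zero (by simp)]
  exact component_eq_of_fst_eq h₁ h₂ h₃ s₁ s₂ s₃ hpq.symm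

/-- The part of `Y(ℝ)` over a path in the image of `Y(ℝ) → ℙ¹(ℝ)` is connected. -/
theorem component_eq_of_path {t : ℝ → Fin 2 → ℝ} (ht : Continuous t) {a b : ℝ} (hab : a ≤ b)
    (ht0 : ∀ r ∈ Icc a b, t r ≠ 0) (hN : ∀ r ∈ Icc a b, ¬ NegDef (pencil A₁ A₂ A₃ (t r)))
    {p q : coordinates Q₁ Q₂ Q₃} (hp : p.1.1 = t a) (hq : q.1.1 = t b) :
    component p = component q := by
  have hcont : Continuous fun y : ℝ × (Fin 3 → ℝ) => y.2 ⬝ᵥ pencil A₁ A₂ A₃ (t y.1) *ᵥ y.2 := by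
    have : Continuous fun y : ℝ × (Fin 3 → ℝ) => pencil A₁ A₂ A₃ (t y.1) :=
      continuous_pencil.comp (by fun_prop)
    fun_prop
  let K : Set (ℝ × (Fin 3 → ℝ)) := (Icc a b ×ˢ Metric.sphere (0 : Fin 3 → ℝ) 1) ∩
    {y | 0 ≤ y.2 ⬝ᵥ pencil A₁ A₂ A₃ (t y.1) *ᵥ y.2}
  have hK : IsCompact K := (isCompact_Icc.prod (isCompact_sphere _ _)).inter_right
    (isClosed_le continuous_const hcont)
  have : CompactSpace K := isCompact_iff_compactSpace.1 hK
  let π : K → Icc a b := fun y => ⟨y.1.1, y.2.1.1⟩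
  have hπ : Continuous π := by fun_prop
  have hπs : Function.Surjective π := by
    rintro ⟨r, hr⟩
    obtain ⟨x, hx, hx'⟩ := not_negDef_iff.1 (hN r hr)
    exact ⟨⟨(r, x), ⟨hr, by simpa using hx⟩, hx'⟩, rfl⟩
  have hmem : ∀ y : K, (t y.1.1, y.1.2, √(y.1.2 ⬝ᵥ pencil A₁ A₂ A₃ (t y.1.1) *ᵥ y.1.2)) ∈
      coordinates Q₁ Q₂ Q₃ := by
    rintro ⟨⟨r, x⟩, ⟨hr, hx⟩, hx'⟩
    refine (mem_coordinates_iff h₁ h₂ h₃).2 ⟨ht0 r hr, ?_, Real.sq_sqrt hx'⟩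
    rintro rfl
    simp at hx
  let σ : K → coordinates Q₁ Q₂ Q₃ := fun y => ⟨_, hmem y⟩
  have hσ : Continuous σ := by
    refine Continuous.subtype_mk ?_ _
    exact (ht.comp (by fun_prop)).prodMk ((continuous_snd.comp continuous_subtype_val).prodMk
      (Real.continuous_sqrt.comp (hcont.comp continuous_subtype_val)))
  -- K need not be connected. But π is a closed surjection, hence a quotient map, and the component
  -- is constant on its fibres, so it descends to a continuous function on [a, b].
  have hfac : (fun r => component (σ (Function.surjInv hπs r))) ∘ π = component ∘ σ := by
    funext y
    have : π (Function.surjInv hπs (π y)) = π y := Function.surjInv_eq _ _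
    exact component_eq_of_fst_eq h₁ h₂ h₃ s₁ s₂ s₃ (congrArg (fun r : Icc a b => t r) this)
  have hc : Continuous fun r => component (σ (Function.surjInv hπs r)) := by
    rw [(hπ.isClosedMap.isQuotientMap hπ hπs).continuous_iff, hfac]
    exact continuous_component.comp hσ
  have hfib : ∀ r : Icc a b, (σ (Function.surjInv hπs r)).1.1 = t r := fun r =>
    congrArg (fun r : Icc a b => t r) (Function.surjInv_eq hπs r)
  have : PreconnectedSpace (Icc a b) := Subtype.preconnectedSpace isPreconnected_Icc
  have hE := eq_of_continuous_component hc ⟨a, le_rfl, hab⟩ ⟨b, hab, le_rfl⟩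
  rw [component_eq_of_fst_eq h₁ h₂ h₃ s₁ s₂ s₃ (hp.trans (hfib ⟨a, le_rfl, hab⟩).symm), hE]
  exact component_eq_of_fst_eq h₁ h₂ h₃ s₁ s₂ s₃ ((hfib ⟨b, hab, le_rfl⟩).trans hq.symm)

theorem subsingleton_components (hN : ∀ t, t ≠ 0 → ¬ NegDef (pencil A₁ A₂ A₃ t)) :
    Subsingleton (ConnectedComponents (RealLocus Q₁ Q₂ Q₃)) := by
  refine ⟨component_surjective.forall₂.2 fun p q => ?_⟩
  by_cases hli : LinearIndependent ℝ ![p.1.1, q.1.1]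
  · have ht0 : ∀ r : ℝ, (1 - r) • p.1.1 + r • q.1.1 ≠ 0 := by
      intro r h
      obtain ⟨h1, h2⟩ := LinearIndependent.pair_iff.1 hli _ _ h
      linarith
    exact component_eq_of_path h₁ h₂ h₃ s₁ s₂ s₃
      (t := fun r => (1 - r) • p.1.1 + r • q.1.1) (by fun_prop) zero_le_one
      (fun r _ => ht0 r) (fun r _ => hN _ (ht0 r)) (by simp) (by simp)
  · obtain ⟨a, ha⟩ : ∃ a : ℝ, a • p.1.1 = q.1.1 := by
      by_contra! h
      exact hli ((LinearIndependent.pair_iff' p.2.1).2 h)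
    refine component_eq_of_fst_eq_smul h₁ h₂ h₃ s₁ s₂ s₃ (a := a) ?_ ha.symm
    rintro rfl
    exact q.2.1 (by simpa using ha.symm)

theorem card_components_le_of_negDef {t : Fin 2 → ℝ} (hN : NegDef (pencil A₁ A₂ A₃ t)) :
    ENat.card (ConnectedComponents (RealLocus Q₁ Q₂ Q₃)) ≤ 3 := by
  have ht0 : t ≠ 0 := by
    rintro rfl
    simpa [pencil] using hN 1 one_ne_zero
  have hnorm : t 0 ^ 2 + t 1 ^ 2 ≠ 0 := by
    intro h
    refine ht0 (funext (Fin.forall_fin_two.2 ⟨?_, ?_⟩)) <;> simp <;> nlinarith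
  -- e is t turned by a right angle. The fibre over t is empty, so every point of Y(ℝ) lies over the
  -- chart s t + e.
  let e : Fin 2 → ℝ := ![-t 1, t 0]
  have hpar : ∀ p : coordinates Q₁ Q₂ Q₃, ∃ s a : ℝ, a ≠ 0 ∧ p.1.1 = a • (s • t + e) := by
    intro p
    set α := (p.1.1 0 * t 0 + p.1.1 1 * t 1) / (t 0 ^ 2 + t 1 ^ 2) with hα
    set β := (p.1.1 1 * t 0 - p.1.1 0 * t 1) / (t 0 ^ 2 + t 1 ^ 2) with hβ
    have hp : p.1.1 = α • t + β • e := by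
      funext i
      fin_cases i <;> simp [e, hα, hβ] <;> field_simp <;> ring
    have hβ0 : β ≠ 0 := by
      intro h0
      rw [h0, zero_smul, add_zero] at hp
      have hα0 : α ≠ 0 := by
        intro h
        exact p.2.1 (by rw [hp, h, zero_smul])
      exact not_negDef_of_mem_coordinates h₁ h₂ h₃ p.2 (hp ▸ hN.pencil_smul hα0)
    refine ⟨α / β, β, hβ0, ?_⟩
    rw [hp, smul_add, smul_smul, mul_div_cancel₀ _ hβ0]
  choose s a ha hsa using hpar
  have hte : ∀ r : ℝ, r • t + e ≠ 0 := by
    intro r h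
    have h0 := congrFun h 0
    have h1 := congrFun h 1
    simp [e] at h0 h1
    exact hnorm (by linear_combination (-t 1) * h0 + t 0 * h1)
  have hnot : ∀ p, ¬ NegDef (pencil A₁ A₂ A₃ (s p • t + e)) := fun p h =>
    not_negDef_of_mem_coordinates h₁ h₂ h₃ p.2 (hsa p ▸ h.pencil_smul (ha p))
  have hnormalize : ∀ p, ∃ p', component p' = component p ∧ p'.1.1 = s p • t + e := by
    intro p
    have hp := (mem_coordinates_iff h₁ h₂ h₃).1 p.2
    have hmem : (s p • t + e, p.1.2.1, (a p)⁻¹ * p.1.2.2) ∈ coordinates Q₁ Q₂ Q₃ := by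
      refine (mem_coordinates_iff h₁ h₂ h₃).2 ⟨hte _, hp.2.1, ?_⟩
      have hz := hp.2.2
      have hap := ha p
      rw [hsa p, pencil_smul, smul_mulVec, dotProduct_smul, smul_eq_mul] at hz
      simp only [mul_pow, hz]
      field_simp
    exact ⟨⟨_, hmem⟩, component_eq_of_fst_eq_smul h₁ h₂ h₃ s₁ s₂ s₃ (ha p) (hsa p), rfl⟩
  have hbetween : ∀ p q, s p < s q → component p ≠ component q →
      ∃ r ∈ Ioo (s p) (s q), NegDef (pencil A₁ A₂ A₃ (r • t + e)) := by
    intro p q hpq hne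
    by_contra! hr
    obtain ⟨p', hp', hpt⟩ := hnormalize p
    obtain ⟨q', hq', hqt⟩ := hnormalize q
    refine hne (hp' ▸ hq' ▸ component_eq_of_path h₁ h₂ h₃ s₁ s₂ s₃
      (t := fun r => r • t + e) (by fun_prop) hpq.le (fun r _ => hte r) ?_ hpt hqt)
    intro r hrI
    rcases hrI.1.eq_or_lt with rfl | h1
    · exact hnot p
    rcases hrI.2.eq_or_lt with rfl | h2
    · exact hnot q
    exact hr r ⟨h1, h2⟩
  by_contra! hcard
  obtain ⟨T, -, hT⟩ := Set.exists_subset_encard_eq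
    (s := (univ : Set (ConnectedComponents (RealLocus Q₁ Q₂ Q₃)))) (k := 4)
    (by rw [encard_univ]; exact Order.add_one_le_of_lt hcard)
  have hTfin : T.Finite := finite_of_encard_eq_coe (k := 4) hT
  choose rep hrep using component_surjective (Q₁ := Q₁) (Q₂ := Q₂) (Q₃ := Q₃)
  -- Fibres are connected, so distinct components have distinct parameters.
  have hinj : Function.Injective fun c => s (rep c) := by
    intro c d hcd
    obtain ⟨p', hp', hpt⟩ := hnormalize (rep c)
    obtain ⟨q', hq', hqt⟩ := hnormalize (rep d)
    rw [← hrep c, ← hrep d, ← hp', ← hq']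
    refine component_eq_of_fst_eq h₁ h₂ h₃ s₁ s₂ s₃ ?_
    rw [hpt, hqt]
    exact congrArg (fun r => r • t + e) hcd
  have hF : (hTfin.toFinset.map ⟨_, hinj⟩).card = 4 := by
    rw [Finset.card_map]
    rw [hTfin.encard_eq_coe_toFinset_card] at hT
    exact_mod_cast hT
  have hp : ∀ i : Fin 4, ∃ c, s (rep c) = Finset.orderEmbOfFin _ hF i := by
    intro i
    obtain ⟨c, -, hc⟩ := Finset.mem_map.1 (Finset.orderEmbOfFin_mem _ hF i)
    exact ⟨c, hc⟩
  choose c hc using hp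
  have hmono : StrictMono fun i => s (rep (c i)) := by
    simpa only [hc] using (Finset.orderEmbOfFin _ hF).strictMono
  have hgap : ∀ i j : Fin 4, i < j → ∃ r ∈ Ioo (s (rep (c i))) (s (rep (c j))),
      NegDef (pencil A₁ A₂ A₃ (r • t + e)) := by
    intro i j hij
    refine hbetween _ _ (hmono hij) ?_
    rw [hrep, hrep]
    intro h
    exact (hmono hij).ne (congrArg (fun d => s (rep d)) h)
  -- The outer two of the five negative definite parameters come from a neighbourhood of t,
  -- approached from both ends of the line.
  obtain ⟨r₀, hr₀, hr₀'⟩ := ((eventually_negDef_pencil hN e tendsto_inv_atBot_zero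
    (Filter.eventually_ne_atBot 0)).and (Filter.eventually_lt_atBot (s (rep (c 0))))).exists
  obtain ⟨r₄, hr₄, hr₄'⟩ := ((eventually_negDef_pencil hN e tendsto_inv_atTop_zero
    (Filter.eventually_ne_atTop 0)).and (Filter.eventually_gt_atTop (s (rep (c 3))))).exists
  obtain ⟨r₁, hr₁, hr₁'⟩ := hgap 0 1 (by decide)
  obtain ⟨r₂, hr₂, hr₂'⟩ := hgap 1 2 (by decide)
  obtain ⟨r₃, hr₃, hr₃'⟩ := hgap 2 3 (by decide)
  refine not_negDef_interlacing (B₂ := pencil A₁ A₂ A₃ t)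
    (B₁ := (2 * t 0 * e 0) • A₁ + (2 * (t 0 * e 1 + t 1 * e 0)) • A₂ + (2 * t 1 * e 1) • A₃)
    (B₀ := pencil A₁ A₂ A₃ e) (pencil_isSymm s₁ s₂ s₃ _)
    (((s₁.smul _).add (s₂.smul _)).add (s₃.smul _)) (pencil_isSymm s₁ s₂ s₃ _)
    (ν := ![r₀, r₁, r₂, r₃, r₄]) (s := fun i => s (rep (c i))) ?_ ?_ ?_ ?_
  · intro i
    rw [← pencil_smul_add]
    fin_cases i
    exacts [hr₀, hr₁', hr₂', hr₃', hr₄]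
  · intro i
    rw [← pencil_smul_add]
    exact hnot _
  · intro i
    fin_cases i
    exacts [hr₀', hr₁.2, hr₂.2, hr₃.2]
  · intro i
    fin_cases i
    exacts [hr₁.1, hr₂.1, hr₃.1, hr₄']

end Components

end DoubleCover

/-- `Y(ℝ)` has at most three connected components. Counting sign changes of the binary sextic
`det (t₀² A₁ + 2 t₀ t₁ A₂ + t₁² A₃)` does not need the smoothness of the quartic. -/
theorem lemma2p6 (Q₁ Q₂ Q₃ : MvPolynomial (Fin 3) ℝ)
    (hQ₁ : Q₁.IsHomogeneous 2) (hQ₂ : Q₂.IsHomogeneous 2) (hQ₃ : Q₃.IsHomogeneous 2)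
    (hΔ : DoubleCover.IsSmoothPlaneCurve (Q₁ * Q₃ - Q₂ ^ 2)) :
    ENat.card (ConnectedComponents (DoubleCover.RealLocus Q₁ Q₂ Q₃)) ≤ 3 := by
  obtain ⟨A₁, s₁, h₁⟩ := DoubleCover.exists_isSymm_matrix_eval hQ₁
  obtain ⟨A₂, s₂, h₂⟩ := DoubleCover.exists_isSymm_matrix_eval hQ₂
  obtain ⟨A₃, s₃, h₃⟩ := DoubleCover.exists_isSymm_matrix_eval hQ₃
  by_cases hN : ∃ t, DoubleCover.NegDef (DoubleCover.pencil A₁ A₂ A₃ t)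
  · obtain ⟨t, ht⟩ := hN
    exact DoubleCover.card_components_le_of_negDef h₁ h₂ h₃ s₁ s₂ s₃ ht
  · push Not at hN
    have := DoubleCover.subsingleton_components h₁ h₂ h₃ s₁ s₂ s₃ fun t _ => hN t
    exact (ENat.card_le_one_iff_subsingleton _ |>.2 this).trans (by norm_num)
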